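/- Logarithms are to base $2$ and $[n]=\{1,\dots,n\}$. There is a universal constant $C>0$ such that the following holds. Let $r, L, K_1,\dots,K_r$ be positive integers and, for $i\in[r]$, let $B_i\in\mathbb{C}^{L\times K_i}$ satisfy $B_i^*B_i=\mathrm{Id}_{K_i}$; let $b_{i,\ell}\in\mathbb{C}^{K_i}$ denote the $\ell$-th column of $B_i^*$. Put $$K=\max_{i\in[r]}K_i,\qquad \mu_i^2=\max_{\ell\in[L]}\frac{L}{K_i}\|b_{i,\ell}\|_{\ell_2}^2,\qquad K_\mu=\max_{i\in[r]}K_i\mu_i^2 .$$ Let $P\in[L]$, $\nu\in(0,1)$ and set $Q=L/P$ (a real number, not necessarily an integer). If $$Q\ \ge\ C\,\frac{K_\mu}{\nu^2}\,\log\bigl(\max\{r,P,K\}\bigr),$$ then there is a partition $\{\Gamma_p\}_{p=1}^P$ of $[L]$ into $P$ sets such that $\frac12Q\le|\Gamma_p|\le\frac32Q$ for all $p\in[P]$ and $$\Bigl\|\mathrm{Id}_{K_i}-\frac{L}{Q}\sum_{\ell\in\Gamma_p}b_{i,\ell}b_{i,\ell}^*\Bigr\|_{2\to2}\le\nu\qquad\text{for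 all } i\in[r],\ p\in[P],$$ where $\|\cdot\|_{2\to2}$ is the spectral (Euclidean operator) norm. -/

import Mathlib

open scoped Matrix Matrix.Norms.L2Operator

namespace BlindDemixing

noncomputable section

/-- `b_ℓ`: the `ℓ`-th column of `Bᴴ`, as a vector of `ℂ^k` with the Euclidean norm. -/
def bvec {L k : ℕ} (B : Matrix (Fin L) (Fin k) ℂ) (ℓ : Fin L) : EuclideanSpace ℂ (Fin k) :=
  WithLp.toLp 2 (fun j => Bᴴ j ℓ)

/-- The coherence `μ² = max_ℓ (L / k) ‖b_ℓ‖²` (a maximum over the finite index set `Fin L`). -/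
def coherenceSq {L k : ℕ} (B : Matrix (Fin L) (Fin k) ℂ) : ℝ :=
  ⨆ ℓ : Fin L, (L : ℝ) / (k : ℝ) * ‖bvec B ℓ‖ ^ 2

/-- `K_μ = max_i K_i μ_i²`. -/
def Kmu {L r : ℕ} {K : Fin r → ℕ} (B : (i : Fin r) → Matrix (Fin L) (Fin (K i)) ℂ) : ℝ :=
  ⨆ i : Fin r, (K i : ℝ) * coherenceSq (B i)

/-- `T = (L / Q) ∑_{ℓ ∈ Γ} b_ℓ b_ℓ^*`. -/
def partialFrame {L k : ℕ} (B : Matrix (Fin L) (Fin k) ℂ) (Q : ℝ) (Γ : Finset (Fin L)) :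
    Matrix (Fin k) (Fin k) ℂ :=
  (((L : ℝ) / Q : ℝ) : ℂ) • ∑ ℓ ∈ Γ, Matrix.vecMulVec (bvec B ℓ).ofLp (star (bvec B ℓ).ofLp)

/-- The family `Γ_1, …, Γ_P` is a partition of `[L]`. -/
def IsPartition {L P : ℕ} (Γ : Fin P → Finset (Fin L)) : Prop :=
  (∀ p, (Γ p).Nonempty) ∧ (∀ p q, p ≠ q → Disjoint (Γ p) (Γ q)) ∧ (∀ ℓ, ∃ p, ℓ ∈ Γ p)

end

end BlindDemixing

/-! Label each `ℓ` independently and uniformly by some `p`. With `h = P·1[label = p] - 1`, the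
deviation from the identity is `X = ∑ h(ω ℓ) A ℓ`, where `A ℓ = b_ℓ b_ℓ^*`. Its even trace moments
are bounded by exchangeable pairs: resampling one label, together with a mean value trace
inequality, gives the recursion `E tr X^(2s+2) ≤ (2s+1) β D E tr (X^(2s+1) + 2 X^(2s))`
(`sum_trace_labelSum_pow_le`), with `β` bounding `‖b_ℓ‖²` and `D = P`. If `(2s+1) β D` is small
against `y²`, the right side is absorbed eigenvalue by eigenvalue, so `E tr X^(2s+2) ≤ k y^(2s+2)`
in dimension `k`.

Taking `y = ν/2` and `s` of order `log max{r, P, K}` makes the normalised moments sum to at most 1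
over all `i` and `p`. Block sizes are the same problem for 1×1 matrices `1/L`, so one first-moment
argument (`exists_balanced_labelling`) handles both. -/

namespace BlindDemixing

open scoped ComplexOrder

/-! ### Trace inequalities for Hermitian matrices -/

/-- Joint spectral expansion of the mixed power traces of two Hermitian matrices. -/
theorem exists_trace_pow_mul_pow {n : Type*} [Fintype n] [DecidableEq n] {X Y : Matrix n n ℂ}
    (hX : X.IsHermitian) (hY : Y.IsHermitian) :
    ∃ w : n → n → ℝ, (∀ i j, 0 ≤ w i j) ∧ ∀ a b : ℕ,
      (X ^ a * Y ^ b).trace.re =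
        ∑ i, ∑ j, w i j * (hX.eigenvalues i ^ a * hY.eigenvalues j ^ b) := by
  have hpow : ∀ {Z : Matrix n n ℂ} (hZ : Z.IsHermitian) (a : ℕ),
      Z ^ a = (hZ.eigenvectorUnitary : Matrix n n ℂ) *
        Matrix.diagonal (fun i => ((hZ.eigenvalues i ^ a : ℝ) : ℂ)) *
        star (hZ.eigenvectorUnitary : Matrix n n ℂ) := by
    intro Z hZ a
    conv_lhs => rw [hZ.spectral_theorem]
    rw [← map_pow, Unitary.conjStarAlgAut_apply, Matrix.diagonal_pow]
    congr 3
    ext i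
    simp
  set U := (hX.eigenvectorUnitary : Matrix n n ℂ) with hU
  set V := (hY.eigenvectorUnitary : Matrix n n ℂ) with hV
  set W := star U * V with hW
  -- The weights are the squared overlaps of the two eigenbases; they do not depend on the
  -- exponents.
  refine ⟨fun i j => Complex.normSq (W i j), fun i j => Complex.normSq_nonneg _, fun a b => ?_⟩
  have h1 : (X ^ a * Y ^ b).trace =
      (Matrix.diagonal (fun i => ((hX.eigenvalues i ^ a : ℝ) : ℂ)) * W *
        Matrix.diagonal (fun i => ((hY.eigenvalues i ^ b : ℝ) : ℂ)) * star W).trace := by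
    rw [hpow hX, hpow hY, hW, star_mul, star_star, ← hU, ← hV]
    simp only [Matrix.mul_assoc]
    rw [Matrix.trace_mul_comm U]
    simp only [Matrix.mul_assoc]
  rw [h1, Matrix.trace, Complex.re_sum]
  refine Finset.sum_congr rfl fun i _ => ?_
  rw [Matrix.diag_apply, Matrix.mul_apply, Complex.re_sum]
  refine Finset.sum_congr rfl fun j _ => ?_
  rw [Matrix.mul_diagonal, Matrix.diagonal_mul, Matrix.star_apply]
  have : ((hX.eigenvalues i ^ a : ℝ) : ℂ) * W i j * ((hY.eigenvalues j ^ b : ℝ) : ℂ) * star (W i j)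
      = ((Complex.normSq (W i j) * (hX.eigenvalues i ^ a * hY.eigenvalues j ^ b) : ℝ) : ℂ) := by
    push_cast
    rw [Complex.normSq_eq_conj_mul_self]
    simp only [RCLike.star_def]
    ring
  rw [this, Complex.ofReal_re]

theorem trace_pow_eq_sum_eigenvalues_pow {n : Type*} [Fintype n] [DecidableEq n]
    {X : Matrix n n ℂ} (hX : X.IsHermitian) (a : ℕ) :
    (X ^ a).trace.re = ∑ i, hX.eigenvalues i ^ a := by
  conv_lhs => rw [hX.spectral_theorem]
  rw [← map_pow, Unitary.conjStarAlgAut_apply, Matrix.diagonal_pow, Matrix.trace_mul_comm,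
    ← Matrix.mul_assoc, Unitary.coe_star_mul_self, Matrix.one_mul, Matrix.trace_diagonal,
    Complex.re_sum]
  refine Finset.sum_congr rfl fun i _ => ?_
  simp [← Complex.ofReal_pow]

/-- Factor the difference of powers as a geometric sum and bound each of its `2s+1` terms by the
larger of the two pure powers. -/
theorem sub_mul_pow_sub_pow_le (a b : ℝ) (s : ℕ) :
    (a - b) * (a ^ (2 * s + 1) - b ^ (2 * s + 1)) ≤
      (2 * s + 1) * ((a - b) ^ 2 * (a ^ (2 * s) + b ^ (2 * s))) := by
  have hev : ∀ x : ℝ, |x| ^ (2 * s) = x ^ (2 * s) := fun x => by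
    rw [pow_mul, pow_mul, sq_abs]
  have key : ∑ i ∈ Finset.range (2 * s + 1), a ^ i * b ^ (2 * s - i) ≤
      (2 * s + 1) * (a ^ (2 * s) + b ^ (2 * s)) := by
    have : ∀ i ∈ Finset.range (2 * s + 1),
        a ^ i * b ^ (2 * s - i) ≤ a ^ (2 * s) + b ^ (2 * s) := by
      intro i hi
      have hi' : i + (2 * s - i) = 2 * s := by
        have := Finset.mem_range.1 hi
        omega
      calc a ^ i * b ^ (2 * s - i) ≤ |a| ^ i * |b| ^ (2 * s - i) := by
            rw [← abs_pow, ← abs_pow, ← abs_mul]; exact le_abs_self _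
        _ ≤ max |a| |b| ^ i * max |a| |b| ^ (2 * s - i) := by
            gcongr
            · exact le_max_left _ _
            · exact le_max_right _ _
        _ = max |a| |b| ^ (2 * s) := by rw [← pow_add, hi']
        _ ≤ |a| ^ (2 * s) + |b| ^ (2 * s) := by
            rcases max_choice |a| |b| with h | h <;> rw [h]
            · exact le_add_of_nonneg_right (by positivity)
            · exact le_add_of_nonneg_left (by positivity)
        _ = _ := by rw [hev, hev]
    refine (Finset.sum_le_sum this).trans ?_
    rw [Finset.sum_const, Finset.card_range, nsmul_eq_mul]
    push_cast
    rfl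
  have hg := (Commute.all a b).mul_geom_sum₂ (2 * s + 1)
  simp only [Nat.add_sub_cancel] at hg
  calc (a - b) * (a ^ (2 * s + 1) - b ^ (2 * s + 1))
      = (a - b) ^ 2 * ∑ i ∈ Finset.range (2 * s + 1), a ^ i * b ^ (2 * s - i) := by
        rw [← hg]; ring
    _ ≤ (a - b) ^ 2 * ((2 * s + 1) * (a ^ (2 * s) + b ^ (2 * s))) := by gcongr
    _ = _ := by ring

/-- Mean value trace inequality for odd powers of Hermitian matrices. -/
theorem trace_sub_mul_pow_sub_pow_le {n : Type*} [Fintype n] [DecidableEq n] {X Y : Matrix n n ℂ}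
    (hX : X.IsHermitian) (hY : Y.IsHermitian) (s : ℕ) :
    ((X - Y) * (X ^ (2 * s + 1) - Y ^ (2 * s + 1))).trace.re ≤
      (2 * s + 1) * ((X - Y) ^ 2 * (X ^ (2 * s) + Y ^ (2 * s))).trace.re := by
  -- By cyclicity both sides are combinations of traces `X^a Y^b`, so the scalar inequality can be
  -- integrated against `w`.
  obtain ⟨w, hw, htr⟩ := exists_trace_pow_mul_pow hX hY
  have hl : ((X - Y) * (X ^ (2 * s + 1) - Y ^ (2 * s + 1))).trace =
      (X ^ (2 * s + 2) * Y ^ 0).trace - (X ^ 1 * Y ^ (2 * s + 1)).trace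
        - (X ^ (2 * s + 1) * Y ^ 1).trace + (X ^ 0 * Y ^ (2 * s + 2)).trace := by
    rw [Matrix.trace_mul_comm (X ^ (2 * s + 1)) (Y ^ 1), ← Matrix.trace_sub, ← Matrix.trace_sub,
      ← Matrix.trace_add]
    congr 1
    rw [pow_succ' X (2 * s + 1), pow_succ' Y (2 * s + 1)]
    noncomm_ring
  have hr : ((X - Y) ^ 2 * (X ^ (2 * s) + Y ^ (2 * s))).trace =
      (X ^ (2 * s + 2) * Y ^ 0).trace - 2 * (X ^ (2 * s + 1) * Y ^ 1).trace
        + (X ^ (2 * s) * Y ^ 2).trace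
        + ((X ^ 2 * Y ^ (2 * s)).trace - 2 * (X ^ 1 * Y ^ (2 * s + 1)).trace
        + (X ^ 0 * Y ^ (2 * s + 2)).trace) := by
    have e1 : (X ^ (2 * s + 1) * Y).trace = (X * Y * X ^ (2 * s)).trace := by
      rw [pow_succ, Matrix.mul_assoc, Matrix.trace_mul_comm]
    have e2 : (X ^ (2 * s + 1) * Y).trace = (Y * X * X ^ (2 * s)).trace := by
      rw [Matrix.trace_mul_comm, pow_succ', Matrix.mul_assoc]
    have e3 : (X * Y ^ (2 * s + 1)).trace = (X * Y * Y ^ (2 * s)).trace := by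
      rw [pow_succ', Matrix.mul_assoc]
    have e4 : (X * Y ^ (2 * s + 1)).trace = (Y * X * Y ^ (2 * s)).trace := by
      rw [pow_succ, Matrix.mul_assoc Y, Matrix.trace_mul_comm Y, Matrix.mul_assoc]
    rw [pow_one, pow_one, two_mul (X ^ (2 * s + 1) * Y).trace, two_mul (X * Y ^ (2 * s + 1)).trace]
    nth_rewrite 1 [e1]
    rw [e2]
    nth_rewrite 1 [e3]
    rw [e4, Matrix.trace_mul_comm (X ^ (2 * s)) (Y ^ 2)]
    simp only [← Matrix.trace_sub, ← Matrix.trace_add]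
    congr 1
    rw [pow_add X (2 * s) 2, (pow_mul_comm X (2 * s) 2), pow_add Y (2 * s) 2,
      (pow_mul_comm Y (2 * s) 2)]
    generalize X ^ (2 * s) = A
    generalize Y ^ (2 * s) = B
    noncomm_ring
  rw [hl, hr]
  simp only [Complex.add_re, Complex.sub_re, Complex.re_ofNat, Complex.mul_re, Complex.im_ofNat,
    zero_mul, sub_zero, htr, Finset.mul_sum, ← Finset.sum_sub_distrib, ← Finset.sum_add_distrib]
  refine Finset.sum_le_sum fun i _ => Finset.sum_le_sum fun j _ => ?_
  have := mul_le_mul_of_nonneg_left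
    (sub_mul_pow_sub_pow_le (hX.eigenvalues i) (hY.eigenvalues j) s) (hw i j)
  refine le_of_eq_of_le ?_ (this.trans_eq ?_) <;> ring

/-! ### Exchangeable pairs and the moment recursion -/

/-- Resampling one coordinate of a uniform function gives an exchangeable pair. -/
theorem sum_sum_update_comm {ι κ : Type*} [Fintype ι] [DecidableEq ι] [Fintype κ]
    (F : (ι → κ) → (ι → κ) → ℝ) (ℓ : ι) :
    ∑ ω, ∑ c, F ω (Function.update ω ℓ c) = ∑ ω, ∑ c, F (Function.update ω ℓ c) ω := by
  classical
  rw [← Fintype.sum_prod_type' (f := fun ω c => F ω (Function.update ω ℓ c)),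
    ← Fintype.sum_prod_type' (f := fun ω c => F (Function.update ω ℓ c) ω)]
  have hinv : Function.Involutive
      (fun x : (ι → κ) × κ => (Function.update x.1 ℓ x.2, x.1 ℓ)) := by
    rintro ⟨ω, c⟩
    simp
  rw [← Equiv.sum_comp hinv.toPerm]
  refine Fintype.sum_congr _ _ fun x => ?_
  simp [Function.Involutive.toPerm]

theorem trace_mul_pow_two_mul_nonneg {n : Type*} [Fintype n] [DecidableEq n] {A X : Matrix n n ℂ}
    (hA : A.PosSemidef) (hX : X.IsHermitian) (s : ℕ) : 0 ≤ (A * X ^ (2 * s)).trace.re := by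
  have h := (hA.conjTranspose_mul_mul_same (X ^ s)).trace_nonneg
  rw [(hX.pow s).eq, Matrix.mul_assoc, Matrix.trace_mul_comm, Matrix.mul_assoc, ← pow_add,
    ← two_mul] at h
  exact (Complex.le_def.1 h).1

/-- Split at `|x| = y`: large `x` is absorbed by its own top power, small `x` by that of `y`. The 5
comes from `|x| + 2 ≤ 5/2` in the second case. -/
theorem mul_add_two_mul_pow_le {x y t : ℝ} (hy : 0 < y) (hy1 : y ≤ 1 / 2)
    (ht0 : 0 ≤ t) (ht : t ≤ y ^ 2 / 5) (s : ℕ) :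
    t * (x ^ (2 * s + 1) + 2 * x ^ (2 * s)) ≤ x ^ (2 * s + 2) / 2 + y ^ (2 * s + 2) / 2 := by
  have hx0 : 0 ≤ x ^ (2 * s) := by rw [pow_mul]; positivity
  have hxa : x ≤ |x| := le_abs_self x
  have hfac : t * (x ^ (2 * s + 1) + 2 * x ^ (2 * s)) ≤ x ^ (2 * s) * (t * (|x| + 2)) := by
    have : x ^ (2 * s) * (t * (x + 2)) ≤ x ^ (2 * s) * (t * (|x| + 2)) := by gcongr
    refine le_of_eq_of_le ?_ this
    ring
  rcases le_total y |x| with hxy | hxy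
  · have h1 : t * (|x| + 2) ≤ |x| ^ 2 / 2 := by
      have h2 : t * (|x| + 2) ≤ y ^ 2 / 5 * (|x| + 2) := by gcongr
      nlinarith [mul_nonneg hy.le (sub_nonneg.2 hxy), mul_nonneg (abs_nonneg x) (sub_nonneg.2 hxy),
        mul_nonneg (mul_nonneg hy.le (abs_nonneg x)) (sub_nonneg.2 hy1),
        mul_nonneg (mul_nonneg hy.le (abs_nonneg x)) (sub_nonneg.2 hxy)]
    rw [sq_abs] at h1
    have h3 := mul_le_mul_of_nonneg_left h1 hx0
    have h4 : x ^ (2 * s + 2) = x ^ (2 * s) * x ^ 2 := pow_add _ _ _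
    have h5 : 0 ≤ y ^ (2 * s + 2) := by positivity
    linarith
  · have h1 : t * (|x| + 2) ≤ y ^ 2 / 2 := by
      calc t * (|x| + 2) ≤ y ^ 2 / 5 * (1 / 2 + 2) := by
            gcongr
            exact hxy.trans hy1
        _ = _ := by ring
    have h2 : x ^ (2 * s) ≤ y ^ (2 * s) := by
      rw [← Even.pow_abs (even_two_mul s) x]
      gcongr
    have h3 : x ^ (2 * s) * (t * (|x| + 2)) ≤ y ^ (2 * s) * (y ^ 2 / 2) := by gcongr
    have h4 : y ^ (2 * s + 2) = y ^ (2 * s) * y ^ 2 := pow_add _ _ _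
    have h5 : 0 ≤ x ^ (2 * s + 2) := (even_two_mul (s + 1)).pow_nonneg x
    linarith

section Moments

variable {ι κ n : Type*} [Fintype ι]

/-- The weighted sum `∑ ℓ, h (ω ℓ) A ℓ` of a family of matrices with labels `ω`. -/
noncomputable def labelSum (A : ι → Matrix n n ℂ) (h : κ → ℝ) (ω : ι → κ) : Matrix n n ℂ :=
  ∑ ℓ, h (ω ℓ) • A ℓ

theorem labelSum_isHermitian {A : ι → Matrix n n ℂ} (hA : ∀ ℓ, (A ℓ).IsHermitian) (h : κ → ℝ)
    (ω : ι → κ) : (labelSum A h ω).IsHermitian := by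
  unfold labelSum Matrix.IsHermitian
  rw [Matrix.conjTranspose_sum]
  refine Finset.sum_congr rfl fun ℓ _ => ?_
  rw [Matrix.conjTranspose_smul, (hA ℓ).eq, star_trivial]

theorem labelSum_sub_update [DecidableEq ι] (A : ι → Matrix n n ℂ) (h : κ → ℝ) (ω : ι → κ)
    (ℓ : ι) (c : κ) :
    labelSum A h ω - labelSum A h (Function.update ω ℓ c) = (h (ω ℓ) - h c) • A ℓ := by
  unfold labelSum
  rw [← Finset.sum_sub_distrib, Finset.sum_eq_single ℓ]
  · rw [Function.update_self, sub_smul]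
  · intro b _ hb
    rw [Function.update_of_ne hb, sub_self]
  · simp

variable [Fintype κ] [Fintype n] [DecidableEq n] [DecidableEq ι]

/-- Resample the label of `ℓ`. Swapping the pair turns the left side into a difference of odd
powers, and the mean value inequality leaves a squared increment, a multiple of `A ℓ`. Hypothesis
`hD` makes that factor linear in the labels, so that summing over `ℓ` can reproduce `X`. -/
theorem sum_trace_smul_mul_labelSum_pow_le [Nonempty κ] {A : ι → Matrix n n ℂ}
    (hA : ∀ ℓ, (A ℓ).PosSemidef) {h : κ → ℝ} (h0 : ∑ c, h c = 0) {D : ℝ}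
    (hD : ∀ a b, (h a - h b) ^ 2 ≤ D * (h a + h b + 2)) {β c : ℝ} {ℓ : ι}
    (hc : A ℓ * A ℓ = c • A ℓ) (hcβ : c ≤ β) (hβ : 0 ≤ β) (s : ℕ) :
    ∑ ω, h (ω ℓ) * (A ℓ * labelSum A h ω ^ (2 * s + 1)).trace.re ≤
      (2 * s + 1) * (β * D) *
        ∑ ω, (h (ω ℓ) + 2) * (A ℓ * labelSum A h ω ^ (2 * s)).trace.re := by
  set X := labelSum A h with hX
  have hXh : ∀ ω, (X ω).IsHermitian := labelSum_isHermitian (fun ℓ => (hA ℓ).1) h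
  have hκ : (0 : ℝ) < Fintype.card κ := by exact_mod_cast Fintype.card_pos
  -- Since `h` is centred, averaging over the new label leaves `h (ω ℓ) • A ℓ`.
  have hS : ∑ ω, ∑ c, ((X ω - X (Function.update ω ℓ c)) * X ω ^ (2 * s + 1)).trace.re =
      Fintype.card κ * ∑ ω, h (ω ℓ) * (A ℓ * X ω ^ (2 * s + 1)).trace.re := by
    rw [Finset.mul_sum]
    refine Finset.sum_congr rfl fun ω _ => ?_
    simp only [hX, labelSum_sub_update, Matrix.smul_mul, Matrix.trace_smul, Complex.smul_re,
      smul_eq_mul]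
    rw [← Finset.sum_mul, Finset.sum_sub_distrib, h0]
    simp
    ring
  have hS2 := sum_sum_update_comm
    (fun ω ω' => ((X ω - X ω') * X ω ^ (2 * s + 1)).trace.re) ℓ
  have hV := sum_sum_update_comm
    (fun ω ω' => ((X ω - X ω') ^ 2 * X ω ^ (2 * s)).trace.re) ℓ
  have hmv : 2 * ∑ ω, ∑ c, ((X ω - X (Function.update ω ℓ c)) * X ω ^ (2 * s + 1)).trace.re ≤
      (2 * s + 1) * (2 * ∑ ω, ∑ c,
        ((X ω - X (Function.update ω ℓ c)) ^ 2 * X ω ^ (2 * s)).trace.re) := by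
    rw [two_mul, two_mul (∑ ω, ∑ c, _ : ℝ)]
    nth_rewrite 2 [hS2]
    nth_rewrite 2 [hV]
    simp only [Finset.mul_sum, ← Finset.sum_add_distrib]
    refine Finset.sum_le_sum fun ω _ => Finset.sum_le_sum fun c _ => ?_
    have := trace_sub_mul_pow_sub_pow_le (hXh ω) (hXh (Function.update ω ℓ c)) s
    refine le_of_eq_of_le ?_ (this.trans_eq ?_)
    · rw [← Complex.add_re, ← Matrix.trace_add]
      congr 2
      noncomm_ring
    · rw [← Complex.add_re, ← Matrix.trace_add]
      congr 3
      noncomm_ring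
  have hvar : ∑ ω, ∑ c, ((X ω - X (Function.update ω ℓ c)) ^ 2 * X ω ^ (2 * s)).trace.re ≤
      Fintype.card κ * ((β * D) * ∑ ω, (h (ω ℓ) + 2) * (A ℓ * X ω ^ (2 * s)).trace.re) := by
    rw [Finset.mul_sum, Finset.mul_sum]
    refine Finset.sum_le_sum fun ω _ => ?_
    have ht := trace_mul_pow_two_mul_nonneg (hA ℓ) (hXh ω) s
    calc ∑ b, ((X ω - X (Function.update ω ℓ b)) ^ 2 * X ω ^ (2 * s)).trace.re
        = ∑ b, (h (ω ℓ) - h b) ^ 2 * (c * (A ℓ * X ω ^ (2 * s)).trace.re) := by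
          refine Finset.sum_congr rfl fun b _ => ?_
          rw [hX, labelSum_sub_update, smul_pow, pow_two (A ℓ), hc]
          simp only [Matrix.smul_mul, Matrix.trace_smul, Complex.smul_re, smul_eq_mul]
      _ ≤ ∑ b, (D * (h (ω ℓ) + h b + 2)) * (β * (A ℓ * X ω ^ (2 * s)).trace.re) := by
          refine Finset.sum_le_sum fun b _ => ?_
          have h1 : c * (A ℓ * X ω ^ (2 * s)).trace.re ≤ β * (A ℓ * X ω ^ (2 * s)).trace.re :=
            mul_le_mul_of_nonneg_right hcβ ht
          exact (mul_le_mul_of_nonneg_left h1 (sq_nonneg _)).trans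
            (mul_le_mul_of_nonneg_right (hD _ _) (mul_nonneg hβ ht))
      _ = _ := by
          rw [← Finset.sum_mul, ← Finset.mul_sum, Finset.sum_add_distrib, Finset.sum_add_distrib,
            h0]
          simp
          ring
  rw [hS] at hmv
  have h1 : (0 : ℝ) ≤ 2 * s + 1 := by positivity
  have h2 := mul_le_mul_of_nonneg_left hvar h1
  refine le_of_mul_le_mul_left ?_ hκ
  linarith

/-- Moment recursion for a labelled sum of matrices with centred labels. -/
theorem sum_trace_labelSum_pow_le [Nonempty κ] {A : ι → Matrix n n ℂ}
    (hA : ∀ ℓ, (A ℓ).PosSemidef) (hsum : ∑ ℓ, A ℓ = 1) {h : κ → ℝ} (h0 : ∑ c, h c = 0) {D : ℝ}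
    (hD : ∀ a b, (h a - h b) ^ 2 ≤ D * (h a + h b + 2)) {β : ℝ} {c : ι → ℝ}
    (hc : ∀ ℓ, A ℓ * A ℓ = c ℓ • A ℓ) (hcβ : ∀ ℓ, c ℓ ≤ β) (hβ : 0 ≤ β) (s : ℕ) :
    ∑ ω, (labelSum A h ω ^ (2 * s + 2)).trace.re ≤
      (2 * s + 1) * (β * D) * ∑ ω, ((labelSum A h ω ^ (2 * s + 1)).trace.re +
        2 * (labelSum A h ω ^ (2 * s)).trace.re) := by
  have h1 := Finset.sum_le_sum fun ℓ (_ : ℓ ∈ Finset.univ) =>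
    sum_trace_smul_mul_labelSum_pow_le hA h0 hD (hc ℓ) (hcβ ℓ) hβ s
  rw [← Finset.mul_sum, Finset.sum_comm, Finset.sum_comm (s := Finset.univ (α := ι))] at h1
  have hS : ∀ (ω : ι → κ) (m : ℕ), ∑ ℓ, h (ω ℓ) * (A ℓ * labelSum A h ω ^ m).trace.re =
      (labelSum A h ω ^ (m + 1)).trace.re := by
    intro ω m
    rw [pow_succ']
    nth_rewrite 2 [labelSum]
    rw [Finset.sum_mul, Matrix.trace_sum, Complex.re_sum]
    simp
  have hT : ∀ (ω : ι → κ) (m : ℕ), ∑ ℓ, (A ℓ * labelSum A h ω ^ m).trace.re =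
      (labelSum A h ω ^ m).trace.re := by
    intro ω m
    rw [← Complex.re_sum, ← Matrix.trace_sum, ← Finset.sum_mul, hsum, one_mul]
  simpa only [add_mul, Finset.sum_add_distrib, ← Finset.mul_sum, hS, hT] using h1

/-- Half of the left side reappears on the right after the eigenvalue-wise absorption, and is
subtracted. -/
theorem sum_trace_labelSum_pow_le_card [Nonempty κ] {A : ι → Matrix n n ℂ}
    (hA : ∀ ℓ, (A ℓ).PosSemidef) (hsum : ∑ ℓ, A ℓ = 1) {h : κ → ℝ} (h0 : ∑ c, h c = 0) {D : ℝ}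
    (hD0 : 0 ≤ D) (hD : ∀ a b, (h a - h b) ^ 2 ≤ D * (h a + h b + 2)) {β : ℝ} {c : ι → ℝ}
    (hc : ∀ ℓ, A ℓ * A ℓ = c ℓ • A ℓ) (hcβ : ∀ ℓ, c ℓ ≤ β) (hβ : 0 ≤ β) (s : ℕ)
    {y : ℝ} (hy : 0 < y) (hy1 : y ≤ 1 / 2) (ht : (2 * s + 1) * (β * D) ≤ y ^ 2 / 5) :
    ∑ ω, (labelSum A h ω ^ (2 * s + 2)).trace.re ≤
      Fintype.card (ι → κ) * (Fintype.card n * y ^ (2 * s + 2)) := by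
  have h1 := sum_trace_labelSum_pow_le hA hsum h0 hD hc hcβ hβ s
  have h2 : (2 * s + 1) * (β * D) * ∑ ω, ((labelSum A h ω ^ (2 * s + 1)).trace.re +
        2 * (labelSum A h ω ^ (2 * s)).trace.re) ≤
      ∑ ω, ((labelSum A h ω ^ (2 * s + 2)).trace.re / 2 +
        Fintype.card n * (y ^ (2 * s + 2) / 2)) := by
    rw [Finset.mul_sum]
    refine Finset.sum_le_sum fun ω _ => ?_
    have hX := labelSum_isHermitian (fun ℓ => (hA ℓ).1) h ω
    simp only [trace_pow_eq_sum_eigenvalues_pow hX]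
    rw [Finset.mul_sum, ← Finset.sum_add_distrib, Finset.mul_sum, Finset.sum_div,
      ← nsmul_eq_mul, ← Finset.card_univ, ← Finset.sum_const, ← Finset.sum_add_distrib]
    exact Finset.sum_le_sum fun i _ => mul_add_two_mul_pow_le hy hy1 (by positivity) ht s
  rw [Finset.sum_add_distrib (f := fun ω => _ / 2), ← Finset.sum_div, Finset.sum_const, nsmul_eq_mul,
    Finset.card_univ] at h2
  linarith

end Moments

/-! ### From moments to norms and existence -/

/-- The spectral norm of a Hermitian matrix is controlled by its even power traces. -/
theorem norm_le_of_trace_pow_le {n : Type*} [Fintype n] [DecidableEq n] {X : Matrix n n ℂ}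
    (hX : X.IsHermitian) {y : ℝ} (hy : 0 ≤ y) (s : ℕ)
    (h : (X ^ (2 * s + 2)).trace.re ≤ y ^ (2 * s + 2)) : ‖X‖ ≤ y := by
  have hn : ‖X‖ = ‖(Matrix.diagonal (RCLike.ofReal ∘ hX.eigenvalues) : Matrix n n ℂ)‖ := by
    conv_lhs => rw [hX.spectral_theorem]
    rw [Unitary.conjStarAlgAut_apply, ← Unitary.coe_star, CStarRing.norm_mul_coe_unitary,
      CStarRing.norm_coe_unitary_mul]
  rw [hn, Matrix.l2_opNorm_diagonal, pi_norm_le_iff_of_nonneg hy]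
  intro i
  rw [trace_pow_eq_sum_eigenvalues_pow hX] at h
  have he : Even (2 * s + 2) := even_two_mul (s + 1)
  have h1 : hX.eigenvalues i ^ (2 * s + 2) ≤ y ^ (2 * s + 2) :=
    (Finset.single_le_sum (fun j _ => he.pow_nonneg (hX.eigenvalues j)) (Finset.mem_univ i)).trans h
  rw [← he.pow_abs] at h1
  simpa using le_of_pow_le_pow_left₀ (by omega) hy h1

theorem exists_forall_le_one_of_sum_le {Ω J : Type*} [Fintype Ω] [Nonempty Ω] [Fintype J]
    {F : J → Ω → ℝ} (hF : ∀ j ω, 0 ≤ F j ω) {e : J → ℝ}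
    (h : ∀ j, ∑ ω, F j ω ≤ Fintype.card Ω * e j) (he : ∑ j, e j ≤ 1) :
    ∃ ω, ∀ j, F j ω ≤ 1 := by
  have hs : ∑ ω, ∑ j, F j ω ≤ ∑ _ω : Ω, (1 : ℝ) := by
    rw [Finset.sum_comm]
    calc ∑ j, ∑ ω, F j ω ≤ ∑ j, Fintype.card Ω * e j := Finset.sum_le_sum fun j _ => h j
      _ = Fintype.card Ω * ∑ j, e j := by rw [Finset.mul_sum]
      _ ≤ Fintype.card Ω * 1 := by gcongr
      _ = _ := by simp
  obtain ⟨ω, -, hω⟩ := Finset.exists_le_of_sum_le Finset.univ_nonempty hs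
  exact ⟨ω, fun j =>
    (Finset.single_le_sum (fun j _ => hF j ω) (Finset.mem_univ j)).trans hω⟩

/-! ### Rank-one frames and coherence -/

section Frame

variable {L k : ℕ} (B : Matrix (Fin L) (Fin k) ℂ)

/-- The rank-one matrix `b_ℓ b_ℓ^*`. -/
def frameMatrix (ℓ : Fin L) : Matrix (Fin k) (Fin k) ℂ :=
  Matrix.vecMulVec (bvec B ℓ).ofLp (star (bvec B ℓ).ofLp)

theorem frameMatrix_posSemidef (ℓ : Fin L) : (frameMatrix B ℓ).PosSemidef :=
  Matrix.posSemidef_vecMulVec_self_star _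

theorem star_bvec_dotProduct_bvec (ℓ : Fin L) :
    star (bvec B ℓ).ofLp ⬝ᵥ (bvec B ℓ).ofLp = ((‖bvec B ℓ‖ ^ 2 : ℝ) : ℂ) := by
  rw [EuclideanSpace.norm_sq_eq, dotProduct]
  push_cast
  refine Finset.sum_congr rfl fun j _ => ?_
  rw [Pi.star_apply, RCLike.star_def, Complex.conj_mul']

theorem frameMatrix_mul_self (ℓ : Fin L) :
    frameMatrix B ℓ * frameMatrix B ℓ = (‖bvec B ℓ‖ ^ 2) • frameMatrix B ℓ := by
  rw [frameMatrix, Matrix.vecMulVec_mul_vecMulVec, star_bvec_dotProduct_bvec]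
  ext i j
  simp [Matrix.vecMulVec_apply]
  ring

variable {B}

theorem sum_frameMatrix (hB : Bᴴ * B = 1) : ∑ ℓ, frameMatrix B ℓ = 1 := by
  rw [← hB]
  ext i j
  simp [Matrix.sum_apply, frameMatrix, bvec, Matrix.vecMulVec_apply, Matrix.mul_apply]

theorem sum_norm_bvec_sq (hB : Bᴴ * B = 1) : ∑ ℓ, ‖bvec B ℓ‖ ^ 2 = k := by
  have h := congrArg Matrix.trace (sum_frameMatrix hB)
  rw [Matrix.trace_sum, Matrix.trace_one, Fintype.card_fin] at h
  have : ∀ ℓ, (frameMatrix B ℓ).trace = ((‖bvec B ℓ‖ ^ 2 : ℝ) : ℂ) := fun ℓ => by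
    rw [frameMatrix, Matrix.trace_vecMulVec, dotProduct_comm, star_bvec_dotProduct_bvec]
  simp only [this] at h
  exact_mod_cast h

end Frame

section Coherence

variable {L r : ℕ} {K : Fin r → ℕ} {B : (i : Fin r) → Matrix (Fin L) (Fin (K i)) ℂ}

theorem mul_norm_bvec_sq_le_Kmu (i : Fin r) (hK : 1 ≤ K i) (ℓ : Fin L) :
    L * ‖bvec (B i) ℓ‖ ^ 2 ≤ Kmu B := by
  have hK' : (0 : ℝ) < K i := by exact_mod_cast hK
  calc L * ‖bvec (B i) ℓ‖ ^ 2 = K i * ((L : ℝ) / K i * ‖bvec (B i) ℓ‖ ^ 2) := by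
        field_simp
    _ ≤ K i * coherenceSq (B i) := by
        gcongr
        exact le_ciSup (f := fun ℓ => (L : ℝ) / K i * ‖bvec (B i) ℓ‖ ^ 2)
          (Set.finite_range _).bddAbove ℓ
    _ ≤ Kmu B := le_ciSup (f := fun i => (K i : ℝ) * coherenceSq (B i))
          (Set.finite_range _).bddAbove i

theorem one_le_Kmu (i : Fin r) (hK : 1 ≤ K i) (hL : 0 < L) (hB : (B i)ᴴ * B i = 1) :
    1 ≤ Kmu B := by
  have hL' : (0 : ℝ) < L := by exact_mod_cast hL
  have h : ∑ ℓ, L * ‖bvec (B i) ℓ‖ ^ 2 ≤ ∑ _ℓ : Fin L, Kmu B :=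
    Finset.sum_le_sum fun ℓ _ => mul_norm_bvec_sq_le_Kmu i hK ℓ
  rw [← Finset.mul_sum, sum_norm_bvec_sq hB] at h
  simp only [Finset.sum_const, Finset.card_univ, Fintype.card_fin, nsmul_eq_mul] at h
  have hK' : (1 : ℝ) ≤ K i := by exact_mod_cast hK
  exact hK'.trans (le_of_mul_le_mul_left h hL')

end Coherence

/-! ### Partition labels and simultaneous balance -/

section Labels

/-- The centred and rescaled indicator of the label `p`. -/
noncomputable def partLabel {P : ℕ} (p c : Fin P) : ℝ := (if c = p then (P : ℝ) else 0) - 1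

theorem sum_partLabel {P : ℕ} (p : Fin P) : ∑ c, partLabel p c = 0 := by
  simp [partLabel]

/-- Equality holds when exactly one label is `p`, both sides being `P²`. -/
theorem partLabel_sub_sq_le {P : ℕ} (p a b : Fin P) :
    (partLabel p a - partLabel p b) ^ 2 ≤ P * (partLabel p a + partLabel p b + 2) := by
  have : (0 : ℝ) ≤ P := P.cast_nonneg
  unfold partLabel
  split_ifs <;> nlinarith

theorem labelSum_partLabel {L P : ℕ} {n : Type*} [DecidableEq n] {A : Fin L → Matrix n n ℂ}
    (hsum : ∑ ℓ, A ℓ = 1) (p : Fin P) (ω : Fin L → Fin P) :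
    labelSum A (partLabel p) ω =
      (P : ℝ) • ∑ ℓ ∈ Finset.univ.filter (fun ℓ => ω ℓ = p), A ℓ - 1 := by
  simp only [labelSum, partLabel, sub_smul, one_smul, Finset.sum_sub_distrib, hsum, ite_smul,
    zero_smul, Finset.smul_sum, Finset.sum_filter, smul_ite, smul_zero]

/-- Running the moment bound at `y / 2` buys the decay `4^-(s+1)` that pays for the union over all
blocks and frames. -/
theorem sum_trace_partLabel_div_le {L P : ℕ} {n : Type*} [Fintype n] [DecidableEq n]
    {A : Fin L → Matrix n n ℂ} (hA : ∀ ℓ, (A ℓ).PosSemidef) (hsum : ∑ ℓ, A ℓ = 1) {β : ℝ}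
    {c : Fin L → ℝ} (hc : ∀ ℓ, A ℓ * A ℓ = c ℓ • A ℓ) (hcβ : ∀ ℓ, c ℓ ≤ β) (hβ : 0 ≤ β) (s : ℕ)
    {y : ℝ} (hy : 0 < y) (hy1 : y ≤ 1) (ht : (2 * s + 1) * (β * P) ≤ y ^ 2 / 20) (p : Fin P) :
    ∑ ω, (labelSum A (partLabel p) ω ^ (2 * s + 2)).trace.re / y ^ (2 * s + 2) ≤
      Fintype.card (Fin L → Fin P) * (Fintype.card n * (1 / 4) ^ (s + 1)) := by
  have : Nonempty (Fin P) := ⟨p⟩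
  rw [← Finset.sum_div, div_le_iff₀ (by positivity)]
  refine (sum_trace_labelSum_pow_le_card (y := y / 2) hA hsum (sum_partLabel p) P.cast_nonneg
    (partLabel_sub_sq_le p) hc hcβ hβ s (by positivity) (by linarith) ?_).trans_eq ?_
  · refine ht.trans_eq ?_
    ring
  · rw [div_pow, show 2 * s + 2 = 2 * (s + 1) by ring, pow_mul 2]
    rw [one_div, inv_pow]
    norm_num
    rw [div_eq_mul_inv]
    ring

theorem norm_labelSum_le {L P : ℕ} {n : Type*} [Fintype n] [DecidableEq n]
    {A : Fin L → Matrix n n ℂ} (hA : ∀ ℓ, (A ℓ).PosSemidef) (h : Fin P → ℝ) (ω : Fin L → Fin P)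
    {y : ℝ} (hy : 0 < y) (s : ℕ)
    (hle : (labelSum A h ω ^ (2 * s + 2)).trace.re / y ^ (2 * s + 2) ≤ 1) :
    ‖labelSum A h ω‖ ≤ y := by
  rw [div_le_one (by positivity)] at hle
  exact norm_le_of_trace_pow_le (labelSum_isHermitian (fun ℓ => (hA ℓ).1) h ω) hy.le s hle

theorem trace_labelSum_pow_div_nonneg {L P : ℕ} {n : Type*} [Fintype n] [DecidableEq n]
    {A : Fin L → Matrix n n ℂ} (hA : ∀ ℓ, (A ℓ).PosSemidef) (h : Fin P → ℝ) (ω : Fin L → Fin P)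
    {y : ℝ} (hy : 0 < y) (s : ℕ) :
    0 ≤ (labelSum A h ω ^ (2 * s + 2)).trace.re / y ^ (2 * s + 2) := by
  refine div_nonneg ?_ (by positivity)
  rw [trace_pow_eq_sum_eigenvalues_pow (labelSum_isHermitian (fun ℓ => (hA ℓ).1) h ω)]
  exact Finset.sum_nonneg fun i _ => (even_two_mul (s + 1)).pow_nonneg _

end Labels

/-- Existence of a labelling that is simultaneously balanced for a finite family of frames. -/
theorem exists_balanced_labelling {L r P : ℕ} {K : Fin r → ℕ}
    {A : (i : Fin r) → Fin L → Matrix (Fin (K i)) (Fin (K i)) ℂ} (hL : 0 < L) (hP : 0 < P)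
    (hA : ∀ i ℓ, (A i ℓ).PosSemidef) (hsum : ∀ i, ∑ ℓ, A i ℓ = 1) {c : Fin r → Fin L → ℝ}
    (hc : ∀ i ℓ, A i ℓ * A i ℓ = c i ℓ • A i ℓ) {κ : ℝ} (hκ : 1 ≤ κ)
    (hcκ : ∀ i ℓ, c i ℓ ≤ κ / L) {ν : ℝ} (hν : 0 < ν) (hν1 : ν < 1) (s : ℕ)
    (hs : (2 * s + 1) * (κ / L * P) ≤ ν ^ 2 / 80)
    (hcard : (∑ i, (K i : ℝ)) * P + P ≤ 4 ^ (s + 1)) :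
    ∃ ω : Fin L → Fin P,
      (∀ i p, ‖labelSum (A i) (partLabel p) ω‖ ≤ ν) ∧
      ∀ p, |(P : ℝ) / L * (Finset.univ.filter (fun ℓ => ω ℓ = p)).card - 1| ≤ 1 / 2 := by
  have : Nonempty (Fin P) := ⟨⟨0, hP⟩⟩
  have hL' : (0 : ℝ) < L := by exact_mod_cast hL
  set A₀ : Fin L → Matrix Unit Unit ℂ := fun _ => (1 / L : ℝ) • 1 with hA₀def
  have hA₀ : ∀ ℓ, (A₀ ℓ).PosSemidef := fun ℓ => Matrix.PosSemidef.one.smul (by positivity)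
  have hsum₀ : ∑ ℓ, A₀ ℓ = 1 := by
    rw [hA₀def, Finset.sum_const, Finset.card_univ, Fintype.card_fin, ← Nat.cast_smul_eq_nsmul ℝ,
      smul_smul, mul_one_div_cancel hL'.ne', one_smul]
  have hc₀ : ∀ ℓ, A₀ ℓ * A₀ ℓ = (1 / L : ℝ) • A₀ ℓ := fun ℓ => by
    simp [hA₀def]
  obtain ⟨ω, hω⟩ := exists_forall_le_one_of_sum_le (Ω := Fin L → Fin P)
    (J := (Fin r × Fin P) ⊕ Fin P)
    (F := Sum.elim
      (fun j ω => (labelSum (A j.1) (partLabel j.2) ω ^ (2 * s + 2)).trace.re / ν ^ (2 * s + 2))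
      (fun p ω => (labelSum A₀ (partLabel p) ω ^ (2 * s + 2)).trace.re /
        (1 / 2 : ℝ) ^ (2 * s + 2)))
    (e := Sum.elim (fun j => K j.1 * (1 / 4) ^ (s + 1)) (fun _ => (1 / 4) ^ (s + 1)))
    (by
      rintro (j | p) ω
      · exact trace_labelSum_pow_div_nonneg (hA _) _ _ hν s
      · exact trace_labelSum_pow_div_nonneg hA₀ _ _ (by norm_num) s)
    (by
      rintro (j | p)
      · have := sum_trace_partLabel_div_le (hA j.1) (hsum j.1) (hc j.1) (hcκ j.1)
          (by positivity) s hν hν1.le (hs.trans (by gcongr; norm_num)) j.2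
        simpa using this
      · have := sum_trace_partLabel_div_le hA₀ hsum₀ hc₀ (fun _ => le_rfl)
          -- At `y = 1/2` the requirement is `1/80`; this is why `hs` has 80 where the frames need
          -- only 20.
          (by positivity) s (y := 1 / 2) (by norm_num) (by norm_num) (by
            have h1 : (2 * s + 1) * (1 / L * P) ≤ (2 * s + 1) * (κ / L * P) := by gcongr
            have h2 : ν ^ 2 ≤ 1 := pow_le_one₀ hν.le hν1.le
            linarith) p
        simpa using this)
    (by
      rw [Fintype.sum_sum_type, Fintype.sum_prod_type]
      simp only [Sum.elim_inl, Sum.elim_inr, Finset.sum_const, Finset.card_univ,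
        Fintype.card_fin, nsmul_eq_mul]
      rw [← Finset.mul_sum, ← Finset.sum_mul, one_div, inv_pow, ← mul_assoc, ← add_mul,
        mul_inv_le_iff₀ (by positivity)]
      linarith)
  refine ⟨ω, fun i p => norm_labelSum_le (hA i) _ _ hν s (hω (Sum.inl (i, p))), fun p => ?_⟩
  have h := norm_labelSum_le hA₀ _ _ (by norm_num) s (hω (Sum.inr p))
  rw [labelSum_partLabel hsum₀] at h
  have he : (P : ℝ) • ∑ ℓ ∈ Finset.univ.filter (fun ℓ => ω ℓ = p), A₀ ℓ - 1 =
      Matrix.diagonal (fun _ : Unit =>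
        (((P : ℝ) / L * (Finset.univ.filter (fun ℓ => ω ℓ = p)).card - 1 : ℝ) : ℂ)) := by
    simp only [hA₀def, Finset.sum_const]
    rw [← Nat.cast_smul_eq_nsmul ℝ, smul_smul, smul_smul]
    ext i j
    simp
    ring
  rw [he, Matrix.l2_opNorm_diagonal, pi_norm_const, Complex.norm_real, Real.norm_eq_abs] at h
  exact h

/-- Take `s + 1 = ⌈2 log₂ M⌉`; `M ≥ 2` lets the rounding be absorbed in the logarithm. -/
theorem exists_exponent {M : ℝ} (hM : 2 ≤ M) :
    ∃ s : ℕ, (2 * s + 1 : ℝ) ≤ 6 * Real.logb 2 M ∧ M ^ 4 ≤ 4 ^ (s + 1) := by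
  have hM0 : 0 < M := by linarith
  have hlog : 1 ≤ Real.logb 2 M := by
    rw [Real.le_logb_iff_rpow_le (by norm_num) hM0]
    simpa using hM
  obtain ⟨s, hs⟩ : ∃ s, ⌈2 * Real.logb 2 M⌉₊ = s + 1 :=
    Nat.exists_eq_add_one.2 (Nat.ceil_pos.2 (by linarith))
  have h1 := Nat.ceil_lt_add_one (a := 2 * Real.logb 2 M) (by linarith)
  have h2 := Nat.le_ceil (2 * Real.logb 2 M)
  rw [hs] at h1 h2
  push_cast at h1 h2
  refine ⟨s, by linarith, ?_⟩
  have h3 : M ^ 2 ≤ 2 ^ (s + 1) := by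
    have : Real.logb 2 (M ^ 2) ≤ ((s + 1 : ℕ) : ℝ) := by
      rw [Real.logb_pow]
      push_cast
      exact h2
    rw [Real.logb_le_iff_le_rpow (by norm_num) (by positivity), Real.rpow_natCast] at this
    exact this
  calc M ^ 4 = (M ^ 2) ^ 2 := by ring
    _ ≤ (2 ^ (s + 1)) ^ 2 := by gcongr
    _ = 4 ^ (s + 1) := by rw [← pow_mul, mul_comm, pow_mul]; norm_num

theorem partialFrame_eq {L k : ℕ} (B : Matrix (Fin L) (Fin k) ℂ) (Q : ℝ) (Γ : Finset (Fin L)) :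
    partialFrame B Q Γ = ((L : ℝ) / Q) • ∑ ℓ ∈ Γ, frameMatrix B ℓ := by
  rw [partialFrame]
  ext i j
  simp [frameMatrix]

end BlindDemixing

/-- The norm of the matrix `1 - T` is the spectral norm (operator norm for Euclidean norms). -/
theorem mainTheorem4 :
    ∃ C : ℝ, 0 < C ∧
      ∀ (L r P : ℕ) (K : Fin r → ℕ) (B : (i : Fin r) → Matrix (Fin L) (Fin (K i)) ℂ) (ν Q : ℝ),
        1 ≤ r → (∀ i, 1 ≤ K i) → (∀ i, (B i)ᴴ * B i = 1) →
        1 ≤ P → P ≤ L → 0 < ν → ν < 1 →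
        Q = (L : ℝ) / (P : ℝ) →
        C * (BlindDemixing.Kmu B / ν ^ 2) *
            Real.logb 2 ((max r (max P (Finset.univ.sup K)) : ℕ) : ℝ) ≤ Q →
        ∃ Γ : Fin P → Finset (Fin L),
          BlindDemixing.IsPartition Γ ∧
          (∀ p, Q / 2 ≤ ((Γ p).card : ℝ) ∧ ((Γ p).card : ℝ) ≤ 3 * Q / 2) ∧
          ∀ i p, ‖(1 : Matrix (Fin (K i)) (Fin (K i)) ℂ)
            - BlindDemixing.partialFrame (B i) Q (Γ p)‖ ≤ ν := by
  open BlindDemixing in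
  -- `480 = 6 · 80`, from `exists_exponent` and `exists_balanced_labelling`.
  refine ⟨480, by norm_num, ?_⟩
  intro L r P K B ν Q hr hK hB hP hPL hν hν1 hQ hC
  have hL : 0 < L := by omega
  have hL' : (0 : ℝ) < L := by exact_mod_cast hL
  have hP' : (0 : ℝ) < P := by exact_mod_cast hP
  have hQ0 : 0 < Q := by rw [hQ]; positivity
  have hLQ : (L : ℝ) / Q = P := by rw [hQ]; field_simp
  suffices h : ∃ ω : Fin L → Fin P,
      (∀ i p, ‖labelSum (frameMatrix (B i)) (partLabel p) ω‖ ≤ ν) ∧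
      ∀ p, |(P : ℝ) / L * (Finset.univ.filter (fun ℓ => ω ℓ = p)).card - 1| ≤ 1 / 2 by
    obtain ⟨ω, hnorm, hcard⟩ := h
    have hcard' : ∀ p, Q / 2 ≤ ((Finset.univ.filter (fun ℓ => ω ℓ = p)).card : ℝ) ∧
        ((Finset.univ.filter (fun ℓ => ω ℓ = p)).card : ℝ) ≤ 3 * Q / 2 := by
      intro p
      have h := abs_le.1 (hcard p)
      set N := ((Finset.univ.filter (fun ℓ => ω ℓ = p)).card : ℝ)
      have hN : (P : ℝ) / L * N = N / Q := by rw [hQ]; field_simp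
      rw [hN] at h
      have h1 : N = N / Q * Q := by field_simp
      constructor <;> nlinarith
    refine ⟨fun p => Finset.univ.filter (fun ℓ => ω ℓ = p), ⟨fun p => ?_, ?_, fun ℓ => ?_⟩,
      hcard', fun i p => ?_⟩
    · have h := (hcard' p).1
      rw [← Finset.card_pos]
      have : (0 : ℝ) < ((Finset.univ.filter (fun ℓ => ω ℓ = p)).card : ℝ) := by linarith
      exact_mod_cast this
    · intro p q hpq
      rw [Finset.disjoint_left]
      intro ℓ h1 h2
      exact hpq ((Finset.mem_filter.1 h1).2.symm.trans (Finset.mem_filter.1 h2).2)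
    · exact ⟨ω ℓ, by simp⟩
    · rw [partialFrame_eq, hLQ, norm_sub_rev, ← labelSum_partLabel (sum_frameMatrix (hB i))]
      exact hnorm i p
  -- `P = 1` is separate because the logarithm may vanish; the deviation is then exactly zero.
  -- Otherwise `M ≥ 2`.
  rcases Nat.eq_or_lt_of_le hP with rfl | hP2
  · refine ⟨fun _ => 0, fun i p => ?_, fun p => ?_⟩
    · rw [labelSum_partLabel (sum_frameMatrix (hB i)), Subsingleton.elim p 0]
      simp [sum_frameMatrix (hB i), hν.le]
    · rw [Subsingleton.elim p 0]
      simp [hL'.ne']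
  set M := max r (max P (Finset.univ.sup K)) with hM
  have hMr : r ≤ M := le_max_left _ _
  have hMP : P ≤ M := (le_max_left _ _).trans (le_max_right _ _)
  have hMK : ∀ i, K i ≤ M := fun i =>
    (Finset.le_sup (Finset.mem_univ i)).trans ((le_max_right _ _).trans (le_max_right _ _))
  have hM2 : (2 : ℝ) ≤ M := by exact_mod_cast (show 2 ≤ M by omega)
  have hκ : 1 ≤ Kmu B := one_le_Kmu ⟨0, hr⟩ (hK _) hL (hB _)
  obtain ⟨s, hs1, hs2⟩ := exists_exponent hM2
  refine exists_balanced_labelling hL hP (fun i => frameMatrix_posSemidef (B i))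
    (fun i => sum_frameMatrix (hB i)) (fun i => frameMatrix_mul_self (B i)) hκ
    (fun i ℓ => ?_) hν hν1 s ?_ ?_
  · rw [le_div_iff₀ hL', mul_comm]
    exact mul_norm_bvec_sq_le_Kmu i (hK i) ℓ
  · have h1 : Kmu B / L * P = Kmu B / Q := by rw [hQ]; field_simp
    have h2 : 480 * (Kmu B * Real.logb 2 M) ≤ Q * ν ^ 2 := by
      rw [← div_le_iff₀ (by positivity)]
      refine le_of_eq_of_le ?_ hC
      ring
    rw [h1, mul_div_assoc', div_le_iff₀ hQ0]
    have h3 := mul_le_mul_of_nonneg_right hs1 (zero_le_one.trans hκ)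
    linarith
  · refine le_trans ?_ hs2
    have h1 : (∑ i, (K i : ℝ)) ≤ M * M := by
      calc (∑ i, (K i : ℝ)) ≤ ∑ _i : Fin r, (M : ℝ) :=
            Finset.sum_le_sum fun i _ => by exact_mod_cast hMK i
        _ = r * M := by simp
        _ ≤ M * M := by gcongr
    calc (∑ i, (K i : ℝ)) * P + P ≤ M * M * M + M := by gcongr
      _ ≤ (M : ℝ) ^ 4 := by
        nlinarith [pow_le_pow_left₀ (by norm_num) hM2 3]
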